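/- Let $X\subseteq\mathbb{R}^d$ be a Borel set, let $h_1,\dots,h_n\colon X\to\mathbb{R}$ be Borel measurable functions, and let $\mathcal{A}=\mathbb{R}[h_1,\dots,h_n]$ be the unital real algebra of functions on $X$ that they generate. Let $\Sigma\mathcal{A}^2$ denote the set of finite sums of squares of elements of $\mathcal{A}$, and let $L\colon\mathcal{A}\to\mathbb{R}$ be a linear functional that is non-negative on the quadratic module $$\Sigma\mathcal{A}^2+\bigl(1-(h_1^2+\dots+h_n^2)\bigr)\,\Sigma\mathcal{A}^2 .$$ Then there is a finite positive Borel measure $\nu$ on $\mathbb{R}^n$, supported by the closed Euclidean unit ball (that is, $\nu(\{\mathbf{y}:\|\mathbf{y}\|>1\})=0$), such that every polynomial $p\in\mathbb{R}[y_1,\dots,y_n]$ is $\nu$-integrable and $$L\bigl(p(h_1,\dots,h_n)\bigr)=\int_{\|\mathbf{y}\|\le 1}p(\mathbf{y})\,d\nu(\mathbf{y}).$$ -/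

import Mathlib

open MeasureTheory

noncomputable section

/-- The unital real algebra `ℝ[h₁, …, hₙ]` of functions on `X` generated by `h₁, …, hₙ`. -/
abbrev functionAlgebra {d n : ℕ} {X : Set (EuclideanSpace ℝ (Fin d))} (h : Fin n → X → ℝ) :
    Subalgebra ℝ (X → ℝ) :=
  Algebra.adjoin ℝ (Set.range h)

/-- The generator `hᵢ`, as an element of `ℝ[h₁, …, hₙ]`. -/
def functionAlgebra.gen {d n : ℕ} {X : Set (EuclideanSpace ℝ (Fin d))} (h : Fin n → X → ℝ)
    (i : Fin n) : functionAlgebra h :=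
  ⟨h i, Algebra.subset_adjoin (Set.mem_range_self i)⟩

/-- The element `p(h₁, …, hₙ)` of `ℝ[h₁, …, hₙ]`, for a polynomial `p`. -/
def functionAlgebra.subst {d n : ℕ} {X : Set (EuclideanSpace ℝ (Fin d))} (h : Fin n → X → ℝ)
    (p : MvPolynomial (Fin n) ℝ) : functionAlgebra h :=
  MvPolynomial.aeval (functionAlgebra.gen h) p

/-- The quadratic module `ΣA² + g₁ ΣA² + ⋯ + gₘ ΣA²` of a commutative ring `A`,
where `ΣA²` is the set of finite sums of squares of elements of `A`. -/
def quadraticModule {A : Type*} [CommRing A] {m : ℕ} (g : Fin m → A) : Set A :=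
  {f | ∃ (σ₀ : A) (σ : Fin m → A), IsSumSq σ₀ ∧ (∀ j, IsSumSq (σ j)) ∧
    f = σ₀ + ∑ j, g j * σ j}

end

/-! In the coordinates `x i = (1 + h i) / 2`, Bernstein polynomials become products of factors `(1 ±
h i) / 2` with nonnegative weights. Each factor lies in the quadratic module
(`half_one_add_mem_quadraticModuleSubsemiring`), which is closed under products because it has a
single generator. So `L` is nonnegative on Bernstein polynomials, and by Bernstein approximation on
every polynomial nonnegative on the unit cube (`nonneg_of_nonneg_on_cube`). M. Riesz extension and
Riesz–Markov then give a measure on the cube. Nonnegativity of `L` on `g * q ^ 2`, where `g = 1 - ∑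
h i ^ 2`, together with density of polynomials, forces `g ≥ 0` almost everywhere. The image under `x
↦ 2 * x - 1` is the required measure on the ball. -/

/-! ### Bernstein expansions and positivity on the cube. -/

open Filter Topology Finset in
theorem sum_choose_mul_bernstein {R : Type*} [CommRing R] (x : R) {N a : ℕ} (h : a ≤ N) :
    ∑ k ∈ range (N + 1), (k.choose a : R) * ((N.choose k : R) * x ^ k * (1 - x) ^ (N - k)) =
      (N.choose a : R) * x ^ a := by
  obtain ⟨m, rfl⟩ := Nat.exists_eq_add_of_le h
  -- Terms with `k < a` vanish; for `k = a + j` the binomial theorem of degree `m = N - a` remains.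
  rw [add_assoc, Finset.sum_range_add, Finset.sum_eq_zero, zero_add]
  · have hb : ∑ j ∈ range (m + 1), x ^ j * (1 - x) ^ (m - j) * (m.choose j : R) = 1 := by
      rw [← add_pow]; simp
    refine Eq.trans ?_ (congrArg (((a + m).choose a : R) * x ^ a * ·) hb |>.trans (mul_one _))
    rw [Finset.mul_sum]
    refine Finset.sum_congr rfl fun j _ => ?_
    have hc : ((a + m).choose (a + j) : R) * ((a + j).choose a : R) =
        ((a + m).choose a : R) * (m.choose j : R) := by
      have := Nat.choose_mul (n := a + m) (k := a + j) (s := a) (by omega)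
      rw [Nat.add_sub_cancel_left, Nat.add_sub_cancel_left] at this
      rw [← Nat.cast_mul, this, Nat.cast_mul]
    rw [Nat.add_sub_add_left, pow_add]
    linear_combination x ^ a * x ^ j * (1 - x) ^ (m - j) * hc
  · intro k hk
    rw [Nat.choose_eq_zero_of_lt (Finset.mem_range.mp hk)]
    simp

theorem choose_div_choose_mem_Icc {N k : ℕ} (a : ℕ) (hk : k ≤ N) :
    (k.choose a : ℝ) / (N.choose a : ℝ) ∈ Set.Icc (0 : ℝ) 1 :=
  ⟨by positivity, div_le_one_of_le₀ (by exact_mod_cast Nat.choose_le_choose a hk) (by positivity)⟩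

theorem natCast_div_mem_Icc {N k : ℕ} (hk : k ≤ N) : (k : ℝ) / N ∈ Set.Icc (0 : ℝ) 1 :=
  ⟨by positivity, div_le_one_of_le₀ (by exact_mod_cast hk) (by positivity)⟩

open Filter Topology in
/-- `C(k,a)/C(N,a)` is uniformly close to `(k/N)^a` for `k ≤ N`, as `N → ∞`. -/
theorem exists_tendsto_abs_choose_div_sub_pow_le (a : ℕ) :
    ∃ ε : ℕ → ℝ, Tendsto ε atTop (𝓝 0) ∧ ∀ N, a ≤ N → ∀ k ≤ N,
      |(k.choose a : ℝ) / (N.choose a : ℝ) - ((k : ℝ) / N) ^ a| ≤ ε N := by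
  induction a with
  | zero => exact ⟨0, tendsto_const_nhds, by simp⟩
  | succ a ih =>
    obtain ⟨ε, hε, hle⟩ := ih
    -- Passing from `a` to `a + 1` multiplies the ratio by `(k - a) / (N - a)`, which is within `a /
    -- (N - a)` of `k / N`.
    refine ⟨fun N => (a : ℝ) / ((N : ℝ) - a) + ε N, ?_, fun N hN k hk => ?_⟩
    · have : Tendsto (fun N : ℕ => (N : ℝ) - a) atTop atTop :=
        tendsto_atTop_add_const_right _ _ tendsto_natCast_atTop_atTop
      simpa using (this.const_div_atTop (a : ℝ)).add hε
    have hNa : (0 : ℝ) < (N : ℝ) - a := sub_pos.mpr (by exact_mod_cast hN)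
    have hN0 : (0 : ℝ) < N := by exact_mod_cast (by omega : 0 < N)
    have hch : ∀ j : ℕ, (j.choose (a + 1) : ℝ) * (a + 1) = j.choose a * ((j : ℝ) - a) := by
      intro j
      rcases le_or_gt a j with h | h
      · rw [← Nat.cast_sub h]; exact_mod_cast Nat.choose_succ_right_eq j a
      · simp [Nat.choose_eq_zero_of_lt h, Nat.choose_eq_zero_of_lt (h.trans (Nat.lt_succ_self a))]
    have hr : (k.choose (a + 1) : ℝ) / (N.choose (a + 1) : ℝ) =
        (k.choose a : ℝ) / (N.choose a : ℝ) * (((k : ℝ) - a) / ((N : ℝ) - a)) := by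
      have h1 : (N.choose a : ℝ) ≠ 0 := by
        exact_mod_cast (Nat.choose_pos (by omega : a ≤ N)).ne'
      have h2 : (N.choose (a + 1) : ℝ) ≠ 0 := by exact_mod_cast (Nat.choose_pos hN).ne'
      have h3 : (a + 1 : ℝ) ≠ 0 := by positivity
      rw [div_mul_div_comm, ← hch, ← hch, mul_div_mul_right _ _ h3]
    set r := (k.choose a : ℝ) / (N.choose a : ℝ)
    have hr0 := choose_div_choose_mem_Icc a hk
    have hk0 := natCast_div_mem_Icc hk
    have hd : |((k : ℝ) - a) / ((N : ℝ) - a) - (k : ℝ) / N| ≤ a / ((N : ℝ) - a) := by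
      have : ((k : ℝ) - a) / ((N : ℝ) - a) - (k : ℝ) / N =
          -(a / ((N : ℝ) - a) * (1 - (k : ℝ) / N)) := by field_simp; ring
      rw [this, abs_neg, abs_of_nonneg (mul_nonneg (by positivity) (by linarith [hk0.2]))]
      exact mul_le_of_le_one_right (by positivity) (by linarith [hk0.1])
    calc _ = |r * (((k : ℝ) - a) / ((N : ℝ) - a) - (k : ℝ) / N) +
          (r - ((k : ℝ) / N) ^ a) * ((k : ℝ) / N)| := by rw [hr]; ring_nf
      _ ≤ |r| * |((k : ℝ) - a) / ((N : ℝ) - a) - (k : ℝ) / N| +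
          |r - ((k : ℝ) / N) ^ a| * |(k : ℝ) / N| := by
        rw [← abs_mul, ← abs_mul]; exact abs_add_le _ _
      _ ≤ 1 * (a / ((N : ℝ) - a)) + ε N * 1 := by
        refine add_le_add (mul_le_mul ?_ hd (abs_nonneg _) zero_le_one)
          (mul_le_mul (hle N (by omega) k hk) ?_ (abs_nonneg _)
            ((abs_nonneg _).trans (hle N (by omega) k hk)))
        · rw [abs_of_nonneg hr0.1]; exact hr0.2
        · rw [abs_of_nonneg hk0.1]; exact hk0.2
      _ = _ := by ring

theorem abs_prod_sub_prod_le {ι : Type*} (s : Finset ι) {f g : ι → ℝ}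
    (hf : ∀ i ∈ s, f i ∈ Set.Icc (0 : ℝ) 1) (hg : ∀ i ∈ s, g i ∈ Set.Icc (0 : ℝ) 1) :
    |∏ i ∈ s, f i - ∏ i ∈ s, g i| ≤ ∑ i ∈ s, |f i - g i| := by
  classical
  induction s using Finset.induction_on with
  | empty => simp
  | insert i s hi ih =>
    rw [Finset.prod_insert hi, Finset.prod_insert hi, Finset.sum_insert hi]
    have h1 : |∏ j ∈ s, f j| ≤ 1 := by
      rw [Finset.abs_prod]
      refine Finset.prod_le_one (fun _ _ => abs_nonneg _) fun j hj => ?_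
      have := hf j (Finset.mem_insert_of_mem hj)
      rw [abs_of_nonneg this.1]; exact this.2
    have h2 : |g i| ≤ 1 := by
      have := hg i (Finset.mem_insert_self i s)
      rw [abs_of_nonneg this.1]; exact this.2
    have h3 := ih (fun j hj => hf j (Finset.mem_insert_of_mem hj))
      (fun j hj => hg j (Finset.mem_insert_of_mem hj))
    calc _ = |(f i - g i) * ∏ j ∈ s, f j + g i * (∏ j ∈ s, f j - ∏ j ∈ s, g j)| := by ring_nf
      _ ≤ |f i - g i| * |∏ j ∈ s, f j| + |g i| * |∏ j ∈ s, f j - ∏ j ∈ s, g j| := by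
        rw [← abs_mul, ← abs_mul]; exact abs_add_le _ _
      _ ≤ |f i - g i| * 1 + 1 * ∑ j ∈ s, |f j - g j| := by gcongr
      _ = _ := by ring

/-- The tensor product Bernstein polynomial of degree `N` in each variable. -/
noncomputable def mvBernstein {n : ℕ} (N : ℕ) (k : Fin n → ℕ) : MvPolynomial (Fin n) ℝ :=
  ∏ i, ((N.choose (k i) : MvPolynomial (Fin n) ℝ) * MvPolynomial.X i ^ k i *
    (1 - MvPolynomial.X i) ^ (N - k i))

theorem monomial_eq_sum_mvBernstein {n N : ℕ} (a : Fin n →₀ ℕ) (c : ℝ) (h : ∀ i, a i ≤ N) :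
    MvPolynomial.monomial a c = ∑ k ∈ Fintype.piFinset fun _ : Fin n => Finset.range (N + 1),
      (c * ∏ i, ((k i).choose (a i) : ℝ) / (N.choose (a i) : ℝ)) • mvBernstein N k := by
  have hX : ∀ i, (MvPolynomial.X i : MvPolynomial (Fin n) ℝ) ^ a i =
      ∑ k ∈ Finset.range (N + 1), MvPolynomial.C ((k.choose (a i) : ℝ) / (N.choose (a i) : ℝ)) *
        ((N.choose k : MvPolynomial (Fin n) ℝ) * MvPolynomial.X i ^ k *
          (1 - MvPolynomial.X i) ^ (N - k)) := by
    intro i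
    have h1 : (N.choose (a i) : ℝ) ≠ 0 := by exact_mod_cast (Nat.choose_pos (h i)).ne'
    have h2 := sum_choose_mul_bernstein (MvPolynomial.X i : MvPolynomial (Fin n) ℝ) (h i)
    calc _ = MvPolynomial.C ((N.choose (a i) : ℝ)⁻¹) *
          ((N.choose (a i) : MvPolynomial (Fin n) ℝ) * MvPolynomial.X i ^ a i) := by
          rw [← mul_assoc, ← map_natCast (MvPolynomial.C (σ := Fin n) (R := ℝ)), ← map_mul,
            inv_mul_cancel₀ h1, map_one, one_mul]
      _ = _ := by
          rw [← h2, Finset.mul_sum]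
          refine Finset.sum_congr rfl fun k _ => ?_
          rw [div_eq_inv_mul, map_mul, map_natCast, mul_assoc (MvPolynomial.C _)]
  rw [MvPolynomial.monomial_eq, Finsupp.prod_fintype _ _ (by simp)]
  simp_rw [hX]
  rw [Finset.prod_univ_sum, Finset.mul_sum]
  refine Finset.sum_congr rfl fun k _ => ?_
  rw [Finset.prod_mul_distrib, ← mul_assoc, MvPolynomial.smul_eq_C_mul, map_mul, map_prod]
  rfl

-- The exact Bernstein coefficients of a monomial are uniformly close to its values at the grid
-- points `k / N`. The weights `M (mvBernstein N k)` are nonnegative with sum `M 1`, so the total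
-- error tends to zero.
open Filter Topology in
theorem tendsto_sub_sum_mvBernstein {n : ℕ} (M : MvPolynomial (Fin n) ℝ →ₗ[ℝ] ℝ)
    (hM : ∀ N k, 0 ≤ M (mvBernstein N k)) (p : MvPolynomial (Fin n) ℝ) :
    Tendsto (fun N : ℕ => M p - ∑ k ∈ Fintype.piFinset fun _ : Fin n => Finset.range (N + 1),
      MvPolynomial.eval (fun i => (k i : ℝ) / N) p * M (mvBernstein N k)) atTop (𝓝 0) := by
  have h1 : ∀ N, ∑ k ∈ Fintype.piFinset fun _ : Fin n => Finset.range (N + 1),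
      M (mvBernstein N k) = M 1 := by
    intro N
    have := monomial_eq_sum_mvBernstein (n := n) (N := N) 0 1 (by simp)
    rw [show (1 : MvPolynomial (Fin n) ℝ) = MvPolynomial.monomial 0 1 from rfl, this]
    simp
  induction p using MvPolynomial.induction_on' with
  | add p q hp hq =>
    have := hp.add hq
    rw [add_zero] at this
    refine this.congr fun N => ?_
    simp only [map_add, add_mul, Finset.sum_add_distrib]
    ring
  | monomial a c =>
    choose ε hε hle using fun i => exists_tendsto_abs_choose_div_sub_pow_le (a i)
    have hlim : Tendsto (fun N => |c| * (∑ i, ε i N) * M 1) atTop (𝓝 0) := by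
      have := ((tendsto_finsetSum Finset.univ fun i _ => hε i).const_mul |c|).mul_const (M 1)
      simpa using this
    refine squeeze_zero_norm' ?_ hlim
    filter_upwards [eventually_ge_atTop (∑ i, a i)] with N hN
    have haN : ∀ i, a i ≤ N := fun i =>
      (Finset.single_le_sum (f := fun i => a i) (fun _ _ => Nat.zero_le _)
        (Finset.mem_univ i)).trans hN
    have hMp := congrArg M (monomial_eq_sum_mvBernstein a c haN)
    rw [map_sum] at hMp
    rw [hMp, ← Finset.sum_sub_distrib, ← h1 N, Finset.mul_sum]
    refine (norm_sum_le _ _).trans (Finset.sum_le_sum fun k hk => ?_)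
    have hkN : ∀ i, k i ≤ N := fun i => by
      have := Fintype.mem_piFinset.mp hk i
      rw [Finset.mem_range] at this; omega
    rw [map_smul, smul_eq_mul, ← sub_mul, Real.norm_eq_abs, abs_mul, abs_of_nonneg (hM N k),
      MvPolynomial.eval_monomial, Finsupp.prod_fintype _ _ (by simp), ← mul_sub, abs_mul]
    refine mul_le_mul_of_nonneg_right (mul_le_mul_of_nonneg_left ?_ (abs_nonneg c)) (hM N k)
    refine (abs_prod_sub_prod_le _ (fun i _ => choose_div_choose_mem_Icc (a i) (hkN i))
      (fun i _ => ?_)).trans (Finset.sum_le_sum fun i _ => hle i N (haN i) (k i) (hkN i))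
    have := natCast_div_mem_Icc (hkN i)
    exact ⟨pow_nonneg this.1 _, pow_le_one₀ this.1 this.2⟩

/-- A linear functional that is nonnegative on all Bernstein polynomials is nonnegative on
every polynomial that is nonnegative on the unit cube. -/
theorem nonneg_of_nonneg_on_cube {n : ℕ} (M : MvPolynomial (Fin n) ℝ →ₗ[ℝ] ℝ)
    (hM : ∀ N k, 0 ≤ M (mvBernstein N k)) (p : MvPolynomial (Fin n) ℝ)
    (hp : ∀ x : Fin n → unitInterval, 0 ≤ MvPolynomial.eval (fun i => (x i : ℝ)) p) :
    0 ≤ M p := by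
  have h := tendsto_sub_sum_mvBernstein M hM p
  by_contra! hneg
  -- If `M p < 0`, then `M p` is eventually below the error term, so the grid sum is negative; but
  -- all its terms are nonnegative.
  obtain ⟨N, hN⟩ := (h.eventually (lt_mem_nhds hneg)).exists
  refine hN.not_ge (sub_le_self _ (Finset.sum_nonneg fun k hk => mul_nonneg ?_ (hM N k)))
  refine hp fun i => ⟨(k i : ℝ) / N, natCast_div_mem_Icc ?_⟩
  have := Fintype.mem_piFinset.mp hk i
  rw [Finset.mem_range] at this; omega

/-! ### Representing measure on the cube. -/

open unitInterval in
/-- A polynomial in `n` variables as a continuous function on the unit cube. -/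
noncomputable def cubeEval (n : ℕ) : MvPolynomial (Fin n) ℝ →ₐ[ℝ] C(Fin n → I, ℝ) :=
  MvPolynomial.aeval fun i => ⟨fun x => (x i : ℝ), by fun_prop⟩

open unitInterval in
theorem cubeEval_apply {n : ℕ} (p : MvPolynomial (Fin n) ℝ) (x : Fin n → I) :
    cubeEval n p x = MvPolynomial.eval (fun i => (x i : ℝ)) p := by
  induction p using MvPolynomial.induction_on with
  | C a => simp [cubeEval]
  | add p q hp hq => simp [hp, hq]
  | mul_X p i hp => rw [map_mul, ContinuousMap.mul_apply, hp]; simp [cubeEval]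

open unitInterval in
theorem denseRange_cubeEval (n : ℕ) : DenseRange (cubeEval n) := by
  have h : (cubeEval n).range.topologicalClosure = ⊤ := by
    refine ContinuousMap.subalgebra_topologicalClosure_eq_top_of_separatesPoints _ ?_
    intro x y hxy
    obtain ⟨i, hi⟩ := Function.ne_iff.mp hxy
    refine ⟨_, ⟨cubeEval n (MvPolynomial.X i), ⟨_, rfl⟩, rfl⟩, ?_⟩
    simpa [cubeEval_apply, Subtype.coe_inj] using hi
  intro f
  have hf : f ∈ (cubeEval n).range.topologicalClosure := h ▸ Algebra.mem_top
  exact hf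

-- M. Riesz extension from the polynomial functions applies because the constant `‖f‖` dominates
-- `-f`.
open unitInterval in
theorem exists_positive_extension {n : ℕ} (M : MvPolynomial (Fin n) ℝ →ₗ[ℝ] ℝ)
    (hM : ∀ p, (∀ x, 0 ≤ cubeEval n p x) → 0 ≤ M p) :
    ∃ Λ : C(Fin n → I, ℝ) →ₗ[ℝ] ℝ, (∀ p, Λ (cubeEval n p) = M p) ∧ ∀ f, 0 ≤ f → 0 ≤ Λ f := by
  obtain ⟨s, hs⟩ := LinearMap.exists_rightInverse_of_surjective
    (cubeEval n).toLinearMap.rangeRestrict (LinearMap.range_rangeRestrict _)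
  have hs' : ∀ x, cubeEval n (s x) = x := fun x => congrArg Subtype.val (LinearMap.congr_fun hs x)
  let φ : C(Fin n → I, ℝ) →ₗ.[ℝ] ℝ := ⟨LinearMap.range (cubeEval n).toLinearMap, M ∘ₗ s⟩
  have hnonneg : ∀ x : φ.domain, (x : C(Fin n → I, ℝ)) ∈ PointedCone.positive ℝ _ → 0 ≤ φ x := by
    refine fun x hx => hM _ fun y => ?_
    rw [hs']
    exact hx y
  have hdense : ∀ f, ∃ x : φ.domain,
      (x : C(Fin n → I, ℝ)) + f ∈ PointedCone.positive ℝ C(Fin n → I, ℝ) := by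
    refine fun f => ⟨⟨algebraMap ℝ _ ‖f‖, MvPolynomial.C ‖f‖, (cubeEval n).commutes ‖f‖⟩,
      fun x => ?_⟩
    have := neg_le_of_abs_le (f.norm_coe_le_norm x)
    change 0 ≤ ‖f‖ + f x
    linarith
  obtain ⟨Λ, h1, h2⟩ := riesz_extension _ φ hnonneg hdense
  refine ⟨Λ, fun p => ?_, h2⟩
  -- Both `q` and `-q` are nonnegative on the cube, so the choice of section `s` does not matter.
  have hz : ∀ q, cubeEval n q = 0 → M q = 0 := fun q hq => by
    refine le_antisymm ?_ (hM q (by simp [hq]))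
    simpa using hM (-q) (by simp [hq])
  refine (h1 ⟨cubeEval n p, p, rfl⟩).trans ?_
  change M (s ⟨cubeEval n p, p, rfl⟩) = M p
  rw [← sub_eq_zero, ← map_sub]
  exact hz _ (by rw [map_sub, hs', sub_self])

theorem exists_measure_of_positive {X : Type*} [TopologicalSpace X] [T2Space X] [CompactSpace X]
    [MeasurableSpace X] [BorelSpace X] (Λ : C(X, ℝ) →ₗ[ℝ] ℝ) (hΛ : ∀ f, 0 ≤ f → 0 ≤ Λ f) :
    ∃ ν : Measure X, IsFiniteMeasure ν ∧ ∀ f, Λ f = ∫ x, f x ∂ν := by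
  let e : CompactlySupportedContinuousMap X ℝ →ₗ[ℝ] C(X, ℝ) :=
    { toFun := fun f => f.toContinuousMap
      map_add' := fun _ _ => rfl
      map_smul' := fun _ _ => rfl }
  let Λ' := PositiveLinearMap.mk₀ (Λ ∘ₗ e) fun f hf => hΛ _ (show ∀ x, 0 ≤ f x from hf)
  refine ⟨RealRMK.rieszMeasure Λ', inferInstance, fun f => ?_⟩
  exact (RealRMK.integral_rieszMeasure Λ'
    (CompactlySupportedContinuousMap.continuousMapEquiv f)).symm

open unitInterval in
/-- A linear functional on polynomials that is nonnegative on all Bernstein polynomials is given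
by a finite measure on the unit cube. -/
theorem exists_measure_cube {n : ℕ} (M : MvPolynomial (Fin n) ℝ →ₗ[ℝ] ℝ)
    (hM : ∀ N k, 0 ≤ M (mvBernstein N k)) :
    ∃ ν : Measure (Fin n → I), IsFiniteMeasure ν ∧ ∀ p, M p = ∫ x, cubeEval n p x ∂ν := by
  obtain ⟨Λ, h1, h2⟩ := exists_positive_extension M fun p hp =>
    nonneg_of_nonneg_on_cube M hM p fun x => (hp x).trans_eq (cubeEval_apply p x)
  obtain ⟨ν, hν, h⟩ := exists_measure_of_positive Λ h2
  exact ⟨ν, hν, fun p => by rw [← h1, h]⟩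

/-! ### Localizing the support. -/

theorem integrable_continuousMap {X : Type*} [TopologicalSpace X] [CompactSpace X]
    [MeasurableSpace X] [BorelSpace X] (ν : Measure X) [IsFiniteMeasure ν]
    (f : C(X, ℝ)) : Integrable f ν := by
  refine Integrable.of_bound f.continuous.aestronglyMeasurable ‖f‖ ?_
  exact Filter.Eventually.of_forall f.norm_coe_le_norm

/-- If `∫ g q² ≥ 0` for all `q` in a dense set of continuous functions, then `g ≥ 0` almost
everywhere. -/
theorem ae_nonneg_of_integral_mul_sq_nonneg {X : Type*} [TopologicalSpace X] [CompactSpace X]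
    [MeasurableSpace X] [BorelSpace X] (ν : Measure X) [IsFiniteMeasure ν]
    (g : C(X, ℝ)) {S : Set C(X, ℝ)} (hS : Dense S) (h : ∀ q ∈ S, 0 ≤ ∫ x, g x * q x ^ 2 ∂ν) :
    ∀ᵐ x ∂ν, 0 ≤ g x := by
  have hcont : Continuous fun f : C(X, ℝ) => ∫ x, (g * f ^ 2 : C(X, ℝ)) x ∂ν := by
    have hi : Continuous fun f : C(X, ℝ) => ∫ x, f x ∂ν := by
      refine (LipschitzWith.of_dist_le_mul (K := ν.real Set.univ |>.toNNReal)
        fun f₁ f₂ => ?_).continuous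
      rw [dist_eq_norm, ← integral_sub (integrable_continuousMap ν f₁)
        (integrable_continuousMap ν f₂), Real.coe_toNNReal _ measureReal_nonneg, mul_comm]
      refine norm_integral_le_of_norm_le_const (Filter.Eventually.of_forall fun x => ?_)
      rw [dist_eq_norm]
      exact (f₁ - f₂).norm_coe_le_norm x
    exact hi.comp (by fun_prop)
  have hall : ∀ f : C(X, ℝ), 0 ≤ ∫ x, (g * f ^ 2 : C(X, ℝ)) x ∂ν := by
    intro f
    have hcl : IsClosed {f : C(X, ℝ) | 0 ≤ ∫ x, (g * f ^ 2 : C(X, ℝ)) x ∂ν} :=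
      isClosed_le continuous_const hcont
    exact hcl.closure_subset_iff.mpr (fun q hq => h q hq) (hS f)
  -- The square root of the negative part of `g`: testing against it gives minus the integral of the
  -- squared negative part.
  let r : C(X, ℝ) := ⟨fun x => √(max (-g x) 0), by fun_prop⟩
  have hr : ∀ x, g x * r x ^ 2 = -(max (-g x) 0) ^ 2 := by
    intro x
    change g x * √(max (-g x) 0) ^ 2 = _
    rw [Real.sq_sqrt (le_max_right _ _)]
    rcases le_total (-g x) 0 with hx | hx
    · simp [max_eq_right hx]
    · rw [max_eq_left hx]; ring
  have hint : Integrable (fun x => (max (-g x) 0) ^ 2) ν :=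
    integrable_continuousMap ν ⟨fun x => (max (-g x) 0) ^ 2, by fun_prop⟩
  have h0 : ∫ x, (max (-g x) 0) ^ 2 ∂ν = 0 := by
    refine le_antisymm ?_ (integral_nonneg fun x => sq_nonneg _)
    have := hall r
    simp only [ContinuousMap.mul_apply, ContinuousMap.pow_apply, hr, integral_neg] at this
    linarith
  filter_upwards [(integral_eq_zero_iff_of_nonneg (fun x => sq_nonneg _) hint).mp h0] with x hx
  have : max (-g x) 0 = 0 := by simpa using hx
  linarith [max_eq_right_iff.mp this]

/-! ### Products in the quadratic module. -/

/-- The quadratic module of a single element is closed under multiplication. -/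
def quadraticModuleSubsemiring {A : Type*} [CommRing A] (g : A) : Subsemiring A where
  carrier := quadraticModule ![g]
  zero_mem' := ⟨0, 0, .zero, fun _ => .zero, by simp⟩
  one_mem' := ⟨1, 0, .one, fun _ => .zero, by simp⟩
  add_mem' := by
    rintro _ _ ⟨a, s, ha, hs, rfl⟩ ⟨b, t, hb, ht, rfl⟩
    exact ⟨a + b, s + t, ha.add hb, fun j => (hs j).add (ht j), by simp; ring⟩
  mul_mem' := by
    rintro _ _ ⟨a, s, ha, hs, rfl⟩ ⟨b, t, hb, ht, rfl⟩
    -- The product of the two `g`-terms carries `g * g`, a square, so it joins the sum-of-squares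
    -- part.
    refine ⟨a * b + g * g * (s 0 * t 0), fun j => a * t j + s j * b,
      (ha.mul hb).add ((IsSumSq.mul_self g).mul ((hs 0).mul (ht 0))),
      fun j => (ha.mul (ht j)).add ((hs j).mul hb), by simp; ring⟩

theorem mem_quadraticModuleSubsemiring_of_isSumSq {A : Type*} [CommRing A] (g : A) {a : A}
    (ha : IsSumSq a) : a ∈ quadraticModuleSubsemiring g :=
  ⟨a, 0, ha, fun _ => .zero, by simp⟩

theorem mul_mem_quadraticModuleSubsemiring {A : Type*} [CommRing A] (g : A) {a : A}
    (ha : IsSumSq a) : g * a ∈ quadraticModuleSubsemiring g :=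
  ⟨0, fun _ => a, .zero, fun _ => ha, by simp⟩

/-- From `2 * (1 + u) = (1 + u) ^ 2 + (1 - u ^ 2)`, where `1 - u ^ 2` is `g` plus the squares of the
other `y j`. Stating it for `u` covers both `y i` and `-y i`. -/
theorem half_one_add_mem_quadraticModuleSubsemiring {A : Type*} [CommRing A] [Algebra ℝ A]
    {n : ℕ} (y : Fin n → A) (i : Fin n) {u : A} (hu : u ^ 2 = y i ^ 2) :
    (1 / 2 : ℝ) • (1 + u) ∈ quadraticModuleSubsemiring (1 - ∑ i, y i ^ 2) := by
  set g := 1 - ∑ i, y i ^ 2 with hg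
  have hsum : ∑ j, y j ^ 2 = u ^ 2 + ∑ j ∈ Finset.univ.erase i, y j ^ 2 := by
    rw [hu, Finset.add_sum_erase _ (fun j => y j ^ 2) (Finset.mem_univ i)]
  have h4 : IsSumSq (algebraMap ℝ A (1 / 4)) := by
    have : algebraMap ℝ A (1 / 4) = algebraMap ℝ A (1 / 2) * algebraMap ℝ A (1 / 2) := by
      rw [← map_mul]; norm_num
    rw [this]; exact .mul_self _
  have hsq : ∀ a : A, IsSumSq (a ^ 2) := fun a => sq a ▸ .mul_self a
  have key : (1 / 2 : ℝ) • (1 + u) = algebraMap ℝ A (1 / 4) *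
      ((1 + u) ^ 2 + ∑ j ∈ Finset.univ.erase i, y j ^ 2) + g * algebraMap ℝ A (1 / 4) := by
    have h2 : algebraMap ℝ A (1 / 2) = algebraMap ℝ A (1 / 4) * 2 := by
      rw [← map_ofNat (algebraMap ℝ A) 2, ← map_mul]; norm_num
    rw [Algebra.smul_def, hg, hsum, h2]
    ring
  rw [key]
  exact add_mem (mem_quadraticModuleSubsemiring_of_isSumSq _
    (h4.mul ((hsq _).add (IsSumSq.sum fun j _ => hsq _))))
    (mul_mem_quadraticModuleSubsemiring _ h4)

/-! ### Transfer from the cube to the ball. -/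

/-- The representing measure on the unit ball for a functional on polynomials in `y`. -/
theorem exists_measure_of_nonneg_on_quadraticModule {A : Type*} [CommRing A] [Algebra ℝ A]
    {n : ℕ} (y : Fin n → A) (L : A →ₗ[ℝ] ℝ)
    (hL : ∀ f ∈ quadraticModule ![1 - ∑ i, y i ^ 2], 0 ≤ L f) :
    ∃ ν : Measure (EuclideanSpace ℝ (Fin n)),
      IsFiniteMeasure ν ∧
      ν (Metric.closedBall 0 1)ᶜ = 0 ∧
      ∀ p : MvPolynomial (Fin n) ℝ,
        Integrable (fun y : EuclideanSpace ℝ (Fin n) => MvPolynomial.eval (fun i => y i) p) ν ∧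
        L (MvPolynomial.aeval y p) =
          ∫ y in Metric.closedBall (0 : EuclideanSpace ℝ (Fin n)) 1,
            MvPolynomial.eval (fun i => y i) p ∂ν := by
  set Q := quadraticModuleSubsemiring (1 - ∑ i, y i ^ 2)
  let ψ : MvPolynomial (Fin n) ℝ →ₐ[ℝ] A := MvPolynomial.aeval fun i => (1 / 2 : ℝ) • (1 + y i)
  have hψ : ∀ N k, ψ (mvBernstein N k) ∈ Q := by
    intro N k
    rw [mvBernstein, map_prod]
    refine prod_mem fun i _ => ?_
    have h1 : 1 - (1 / 2 : ℝ) • (1 + y i) = (1 / 2 : ℝ) • (1 + -y i) := by module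
    rw [map_mul, map_mul, map_natCast, map_pow, map_pow, map_sub, map_one, MvPolynomial.aeval_X, h1]
    exact mul_mem (mul_mem (natCast_mem _ _)
      (pow_mem (half_one_add_mem_quadraticModuleSubsemiring y i rfl) _))
      (pow_mem (half_one_add_mem_quadraticModuleSubsemiring y i (neg_sq _)) _)
  obtain ⟨μ, hμ, hrep⟩ := exists_measure_cube (L ∘ₗ ψ.toLinearMap) fun N k => hL _ (hψ N k)
  -- The inverse change of variables, so that `ψ ∘ τ` is evaluation at `y`; `T` below is the same
  -- map on points.
  let τ : MvPolynomial (Fin n) ℝ →ₐ[ℝ] MvPolynomial (Fin n) ℝ :=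
    MvPolynomial.aeval fun i => 2 * MvPolynomial.X i - 1
  have hψτ : ∀ p, ψ (τ p) = MvPolynomial.aeval y p := by
    have h2 : ∀ a : A, (2 : A) * (1 / 2 : ℝ) • a = a := fun a => by
      rw [two_mul]; module
    intro p
    change (ψ.comp τ) p = _
    congr 1
    refine MvPolynomial.algHom_ext fun i => ?_
    simp only [ψ, τ, AlgHom.comp_apply, MvPolynomial.aeval_X, map_sub, map_mul, map_ofNat, map_one,
      h2, add_sub_cancel_left]
  let T : (Fin n → unitInterval) → EuclideanSpace ℝ (Fin n) :=
    fun x => WithLp.toLp 2 fun i => 2 * (x i : ℝ) - 1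
  have hT : Continuous T := by fun_prop
  have hev : ∀ p x, MvPolynomial.eval (fun i => T x i) p = cubeEval n (τ p) x := by
    intro p x
    induction p using MvPolynomial.induction_on with
    | C a => simp [cubeEval, τ]
    | add p q hp hq => simp [hp, hq]
    | mul_X p i hp =>
      rw [map_mul, map_mul, map_mul, ContinuousMap.mul_apply, ← hp]
      simp [cubeEval_apply, τ, T]
  have hpc : ∀ p : MvPolynomial (Fin n) ℝ, Continuous fun y : EuclideanSpace ℝ (Fin n) =>
      MvPolynomial.eval (fun i => y i) p := fun p =>
    (MvPolynomial.continuous_eval p).comp (by fun_prop)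
  let G : MvPolynomial (Fin n) ℝ := 1 - ∑ i, MvPolynomial.X i ^ 2
  have hG : ∀ᵐ x ∂μ, 0 ≤ cubeEval n (τ G) x := by
    refine ae_nonneg_of_integral_mul_sq_nonneg μ _ (denseRange_cubeEval n) ?_
    rintro _ ⟨q, rfl⟩
    have h1 := hrep (τ G * q ^ 2)
    simp only [map_mul, map_pow, ContinuousMap.mul_apply, ContinuousMap.pow_apply] at h1
    rw [← h1]
    change 0 ≤ L (ψ (τ G * q ^ 2))
    rw [map_mul, hψτ, map_pow, sq (ψ q)]
    have hGy : MvPolynomial.aeval y G = 1 - ∑ i, y i ^ 2 := by simp [G]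
    rw [hGy]
    exact hL _ (mul_mem_quadraticModuleSubsemiring _ (.mul_self _))
  have hball : (μ.map T) (Metric.closedBall 0 1)ᶜ = 0 := by
    rw [Measure.map_apply hT.measurable Metric.isClosed_closedBall.measurableSet.compl]
    change ∀ᵐ x ∂μ, T x ∈ Metric.closedBall 0 1
    filter_upwards [hG] with x hx
    rw [← hev] at hx
    have hn : ‖T x‖ ^ 2 ≤ 1 := by
      rw [EuclideanSpace.real_norm_sq_eq]
      simpa [G] using hx
    rw [mem_closedBall_zero_iff]
    exact (sq_le_one_iff₀ (norm_nonneg _)).mp hn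
  refine ⟨μ.map T, inferInstance, hball, fun p => ⟨?_, ?_⟩⟩
  · rw [integrable_map_measure (hpc p).aestronglyMeasurable hT.aemeasurable]
    exact (integrable_continuousMap μ (cubeEval n (τ p))).congr
      (Filter.Eventually.of_forall fun x => (hev p x).symm)
  · rw [Measure.restrict_eq_self_of_ae_mem (s := Metric.closedBall 0 1) (mem_ae_iff.mpr hball),
      integral_map hT.aemeasurable (hpc p).aestronglyMeasurable]
    simp_rw [hev]
    rw [← hrep, ← hψτ]
    rfl

theorem mainTheorem7 {d n : ℕ} (X : Set (EuclideanSpace ℝ (Fin d))) (hX : MeasurableSet X)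
    (h : Fin n → X → ℝ) (hh : ∀ i, Measurable (h i))
    (L : functionAlgebra h →ₗ[ℝ] ℝ)
    (hL : ∀ f ∈ quadraticModule ![1 - ∑ i, functionAlgebra.gen h i ^ 2], 0 ≤ L f) :
    ∃ ν : Measure (EuclideanSpace ℝ (Fin n)),
      IsFiniteMeasure ν ∧
      ν (Metric.closedBall 0 1)ᶜ = 0 ∧
      ∀ p : MvPolynomial (Fin n) ℝ,
        Integrable (fun y : EuclideanSpace ℝ (Fin n) => MvPolynomial.eval (fun i => y i) p) ν ∧
        L (functionAlgebra.subst h p) =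
          ∫ y in Metric.closedBall (0 : EuclideanSpace ℝ (Fin n)) 1,
            MvPolynomial.eval (fun i => y i) p ∂ν :=
  exists_measure_of_nonneg_on_quadraticModule (functionAlgebra.gen h) L hL
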